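/- Let $n\ge 2$. A matrix $A\in\mathbb{R}^{n\times n}$ is totally nonnegative (TN) [totally positive (TP)] if all its minors are nonnegative [positive]; it is oscillatory if it is TN and $A^k$ is TP for some integer $k\ge 1$, and then its exponent $r(A)$ is the least integer $k\ge1$ such that $A^k$ is TP. For $i\in\{2,\dots,n\}$ and $q\in\mathbb{R}$ let $L_i(q):=I+qE_{i,i-1}$, where $E_{i,i-1}$ is the matrix whose only nonzero entry is a one in row $i$ and column $i-1$. Let $W_i$ denote a product of the form $L_n(q_n)L_{n-1}(q_{n-1})\cdots L_i(q_i)$ with nonnegative multipliers $q_n,\dots,q_i$; different occurrences of $L_i$ and $W_i$ may have different multipliers. For $s\in\{2,\dots,n\}$ define two classes of $n\times n$ matrices: (1) $Z_1(s)$ is the class of all products $W_2W_3\cdots W_s$ in which all the multipliers are positive, and $\mu_1(s):=\left\lceil\frac{n-1}{s-1}\right\rceil$; (2) $Z_2(s)$, for $s\ge 3$, is the class of all products $L_2\cdots L_{s-2}\,P\,W_s\cdots W_n$ in which all the multipliers outside $P$ are positive and $P=W_{s-1}$ is a product in which the multiplier of $L_{s-1}$ is positive and at least one of the other multipliers (those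 of $L_n,\dots,L_s$) is zero; $Z_2(2)$ is the class of all products $W_2W_3\cdots W_n$ in which all the multipliers are positive; and $\mu_2(s):=s-1$. Say that a matrix belongs to $Z_i(s)$ multiplied by additional terms if it is a product of matrices $L_k(q)$, $k\in\{2,\dots,n\}$, $q\ge0$, that is obtained from one of the above factorizations of a member of $Z_i(s)$ by adding (possibly no) further factors of this form, at arbitrary positions. Let $A=LDU\in\mathbb{R}^{n\times n}$ be oscillatory, where $D$ is a diagonal matrix with positive diagonal entries. If there exist $i,j\in\{1,2\}$ and $s_i,s_j\in\{2,\dots,n\}$ such that either $L\in Z_i(s_i)$ and $U^T$ belongs to $Z_j(s_j)$ multiplied by additional terms, or $U^T\in Z_j(s_j)$ and $L$ belongs to $Z_i(s_i)$ multiplied by additional terms, then $$r(A)\le\max\{\mu_i(s_i),\mu_j(s_j)\}.$$ -/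

import Mathlib

noncomputable section

namespace OscExp

/-- A square real matrix is totally nonnegative if all its minors are nonnegative. Minors are
indexed by strictly increasing choices of `k` rows and `k` columns (for `k = 0` the empty minor
equals `1`, so it imposes no condition). -/
def IsTN {n : ℕ} (A : Matrix (Fin n) (Fin n) ℝ) : Prop :=
  ∀ (k : ℕ) (f g : Fin k ↪o Fin n), 0 ≤ (A.submatrix f g).det

/-- A square real matrix is totally positive if all its minors are positive. -/
def IsTP {n : ℕ} (A : Matrix (Fin n) (Fin n) ℝ) : Prop :=
  ∀ (k : ℕ) (f g : Fin k ↪o Fin n), 0 < (A.submatrix f g).det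

/-- A matrix is oscillatory if it is totally nonnegative and some positive power of it is
totally positive. -/
def IsOscillatory {n : ℕ} (A : Matrix (Fin n) (Fin n) ℝ) : Prop :=
  IsTN A ∧ ∃ k : ℕ, 0 < k ∧ IsTP (A ^ k)

/-- The exponent `r(A)` of an oscillatory matrix: the least positive integer `k` such that `A ^ k`
is totally positive. -/
def exponent {n : ℕ} (A : Matrix (Fin n) (Fin n) ℝ) : ℕ :=
  sInf {k : ℕ | 0 < k ∧ IsTP (A ^ k)}

/-- The elementary bidiagonal matrix `L_i(q) = I + q E_{i,i-1}`, `2 ≤ i ≤ n`, where rows and columns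
are numbered `1, …, n` (so the row number of `a : Fin n` is `a + 1`). -/
def elemL (n i : ℕ) (q : ℝ) : Matrix (Fin n) (Fin n) ℝ :=
  1 + Matrix.of fun a b : Fin n => if (a : ℕ) + 1 = i ∧ (b : ℕ) + 1 = i - 1 then q else 0

/-- A formal product of elementary bidiagonal matrices: the entry `(i, q)` stands for `L_i(q)`. -/
abbrev LWord : Type := List (ℕ × ℝ)

/-- The matrix represented by a formal product, multiplied out from left to right. -/
def LWord.toMatrix (n : ℕ) (w : LWord) : Matrix (Fin n) (Fin n) ℝ :=
  (w.map fun p => elemL n p.1 p.2).prod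

/-- The factors `L_n(v n) L_{n-1}(v (n-1)) ⋯ L_i(v i)` of `W_i`; here `v j` is the multiplier of
`L_j`. -/
def wordW (n i : ℕ) (v : ℕ → ℝ) : LWord :=
  (List.range' i (n + 1 - i)).reverse.map fun j => (j, v j)

/-- The factors of `W_a W_{a+1} ⋯ W_b`; here `ℓ i j` is the multiplier of `L_j` in `W_i`. -/
def wordWs (n a b : ℕ) (ℓ : ℕ → ℕ → ℝ) : LWord :=
  (List.range' a (b + 1 - a)).flatMap fun i => wordW n i (ℓ i)

/-- The factors of `L_a(c a) L_{a+1}(c (a+1)) ⋯ L_b(c b)` (empty when `b < a`). -/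
def wordAsc (a b : ℕ) (c : ℕ → ℝ) : LWord :=
  (List.range' a (b + 1 - a)).map fun j => (j, c j)

/-- The multipliers `v` define a member of `Ψ_i`: the multiplier of `L_i` in `W_i` is positive, the
other ones (those of `L_{i+1}, …, L_n`) are nonnegative and at least one of them vanishes. -/
def IsPsi (n i : ℕ) (v : ℕ → ℝ) : Prop :=
  0 < v i ∧ (∀ j ∈ Finset.Icc (i + 1) n, 0 ≤ v j) ∧ ∏ j ∈ Finset.Icc (i + 1) n, v j = 0

/-- Factorizations `W_2 W_3 ⋯ W_s`, `2 ≤ s ≤ n`, with all multipliers positive. -/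
def IsZ1Word (n s : ℕ) (w : LWord) : Prop :=
  2 ≤ s ∧ s ≤ n ∧ ∃ ℓ : ℕ → ℕ → ℝ,
    (∀ i ∈ Finset.Icc 2 s, ∀ j ∈ Finset.Icc i n, 0 < ℓ i j) ∧ w = wordWs n 2 s ℓ

/-- Factorizations `L_2 ⋯ L_{s-2} P W_s ⋯ W_n` with `P ∈ Ψ_{s-1}`, `3 ≤ s ≤ n`, and all multipliers
outside `P` positive; for `s = 2` they are `W_2 ⋯ W_n`. -/
def IsZ2Word (n s : ℕ) (w : LWord) : Prop :=
  2 ≤ s ∧ s ≤ n ∧ ∃ ℓ : ℕ → ℕ → ℝ,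
    (∀ i ∈ Finset.Icc s n, ∀ j ∈ Finset.Icc i n, 0 < ℓ i j) ∧
    ((s = 2 ∧ w = wordWs n 2 n ℓ) ∨
      (3 ≤ s ∧ ∃ c p : ℕ → ℝ, (∀ j ∈ Finset.Icc 2 (s - 2), 0 < c j) ∧ IsPsi n (s - 1) p ∧
        w = wordAsc 2 (s - 2) c ++ wordW n (s - 1) p ++ wordWs n s n ℓ))

/-- The index `i ∈ {1, 2}` of the two classes. -/
inductive ZIndex : Type
  | one : ZIndex
  | two : ZIndex

/-- The factorizations that define the class `Z_i(s)`. -/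
def IsZWord (n : ℕ) : ZIndex → ℕ → LWord → Prop
  | ZIndex.one => IsZ1Word n
  | ZIndex.two => IsZ2Word n

/-- The class `Z_i(s)` of `n × n` matrices (empty unless `2 ≤ s ≤ n`). -/
def Z (n : ℕ) (i : ZIndex) (s : ℕ) : Set (Matrix (Fin n) (Fin n) ℝ) :=
  {M | ∃ w : LWord, IsZWord n i s w ∧ M = LWord.toMatrix n w}

/-- The matrices of the class `Z_i(s)` multiplied by additional terms: products of elementary
bidiagonal matrices `L_k(q)`, `q ≥ 0`, obtained from a factorization defining a member of `Z_i(s)`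
by adding further factors, at any positions (on the left, on the right, or in between). -/
def ZWithTerms (n : ℕ) (i : ZIndex) (s : ℕ) : Set (Matrix (Fin n) (Fin n) ℝ) :=
  {M | ∃ w v : LWord, IsZWord n i s w ∧ w.Sublist v ∧
    (∀ p ∈ v, 2 ≤ p.1 ∧ p.1 ≤ n ∧ 0 ≤ p.2) ∧ M = LWord.toMatrix n v}

/-- The numbers `μ_1(s) = ⌈(n - 1) / (s - 1)⌉` and `μ_2(s) = s - 1`, for `2 ≤ s ≤ n`. -/
def mu (n : ℕ) : ZIndex → ℕ → ℕ
  | ZIndex.one, s => ⌈((n : ℝ) - 1) / ((s : ℝ) - 1)⌉₊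
  | ZIndex.two, s => s - 1

end OscExp

end

namespace OscExp

open Matrix Function

/-! ### Relations between column selections realized by right multiplication -/

/-! Track which column sets carry positive minors, starting from the identity, whose minor with rows
and columns `f` is `1`. Right multiplication by `L_i(q)` adds `q` times column `i` to column `i -
1`. By multilinearity, a minor of a TN matrix stays at least as large, and for `q > 0` a positive
minor using column `i` makes positive the one using `i - 1` instead, if that was free. So factors of
`L` let entries of a selection hop down, factors of `Uᵀ`, transposed, let them hop up, and any
factor may idle. Additional factors are therefore harmless.

Two combinatorial facts bound the exponent: `μ_i(s)` copies of a word containing a `Z_i(s)` word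
bring every selection to the bottom one (`iter_bottom_of_isZWord`), and reversed paths climb from
the bottom to any selection. Running these in succession would give the sum of the two numbers. The
maximum comes from superposing them: the admissible moves are closed under pointwise suprema, and
the supremum of a path from `f` to the bottom and a path from the bottom to `g` is a path from `f`
to `g`. Hence every minor of the power is positive. -/

/-- Right multiplication by `M` preserves total nonnegativity, and carries positive minors with
columns `g` to positive minors with columns `g'` whenever `R g g'`; the relation `R` is closed
under pointwise suprema. -/
structure Conducts {n k : ℕ} (M : Matrix (Fin n) (Fin n) ℝ)
    (R : (Fin k → Fin n) → (Fin k → Fin n) → Prop) : Prop where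
  isTN_mul : ∀ N, IsTN N → IsTN (N * M)
  det_pos : ∀ N, IsTN N → ∀ f g g' : Fin k → Fin n, StrictMono f → R g g' →
    0 < (N.submatrix f g).det → 0 < ((N * M).submatrix f g').det
  sup : ∀ g g' h h', R g g' → R h h' → R (g ⊔ h) (g' ⊔ h')

theorem strictMono_sup {n k : ℕ} {g h : Fin k → Fin n} (hg : StrictMono g) (hh : StrictMono h) :
    StrictMono (g ⊔ h) := fun _ _ hab => max_lt_max (hg hab) (hh hab)

theorem IsTN.det_nonneg {n k : ℕ} {N : Matrix (Fin n) (Fin n) ℝ} (hN : IsTN N)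
    {f g : Fin k → Fin n} (hf : StrictMono f) (hg : StrictMono g) :
    0 ≤ (N.submatrix f g).det :=
  hN k (OrderEmbedding.ofStrictMono f hf) (OrderEmbedding.ofStrictMono g hg)

/-- The relation realized by matrices with positive principal minors: equality. -/
def Stay {n k : ℕ} (g g' : Fin k → Fin n) : Prop := StrictMono g ∧ g = g'

theorem conducts_diagonal {n k : ℕ} {d : Fin n → ℝ} (hd : ∀ a, 0 < d a) :
    Conducts (k := k) (diagonal d) Stay := by
  have key : ∀ (m : ℕ) (N : Matrix (Fin n) (Fin n) ℝ) (f g : Fin m → Fin n),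
      ((N * diagonal d).submatrix f g).det = (∏ l, d (g l)) * (N.submatrix f g).det := by
    intro m N f g
    have : (N * diagonal d).submatrix f g =
        of fun a b => (fun l => d (g l)) b * (N.submatrix f g) a b := by
      ext a b
      simp [mul_comm]
    rw [this, det_mul_row]
  refine ⟨fun N hN m f g => ?_, ?_, ?_⟩
  · rw [key]
    exact mul_nonneg (Finset.prod_nonneg fun l _ => (hd _).le) (hN m f g)
  · rintro N - f g _ - ⟨-, rfl⟩ hpos
    rw [key]
    exact mul_pos (Finset.prod_pos fun l _ => hd _) hpos
  · rintro g _ h _ ⟨hg, rfl⟩ ⟨hh, rfl⟩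
    exact ⟨strictMono_sup hg hh, rfl⟩

theorem conducts_one {n k : ℕ} : Conducts (k := k) (1 : Matrix (Fin n) (Fin n) ℝ) Stay := by
  rw [← diagonal_one]
  exact conducts_diagonal fun _ => one_pos

theorem Conducts.mul {n k : ℕ} {M M' : Matrix (Fin n) (Fin n) ℝ}
    {R R' : (Fin k → Fin n) → (Fin k → Fin n) → Prop} (h : Conducts M R) (h' : Conducts M' R') :
    Conducts (M * M') (Relation.Comp R R') where
  isTN_mul N hN := by
    rw [← mul_assoc]
    exact h'.isTN_mul _ (h.isTN_mul _ hN)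
  det_pos N hN f g g' hf := by
    rintro ⟨x, hgx, hxg⟩ hpos
    rw [← mul_assoc]
    exact h'.det_pos _ (h.isTN_mul _ hN) f x g' hf hxg (h.det_pos N hN f g x hf hgx hpos)
  sup g g' u u' := by
    rintro ⟨x, hgx, hxg⟩ ⟨y, huy, hyu⟩
    exact ⟨x ⊔ y, h.sup _ _ _ _ hgx huy, h'.sup _ _ _ _ hxg hyu⟩

/-- The `m`-fold composition of a relation between increasing selections. -/
def Iter {n k : ℕ} (R : (Fin k → Fin n) → (Fin k → Fin n) → Prop) :
    ℕ → (Fin k → Fin n) → (Fin k → Fin n) → Prop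
  | 0 => Stay
  | m + 1 => Relation.Comp (Iter R m) R

theorem Conducts.pow {n k : ℕ} {M : Matrix (Fin n) (Fin n) ℝ}
    {R : (Fin k → Fin n) → (Fin k → Fin n) → Prop} (h : Conducts M R) (m : ℕ) :
    Conducts (M ^ m) (Iter R m) := by
  induction m with
  | zero => simpa [Iter] using conducts_one
  | succ m ih =>
    rw [pow_succ]
    exact ih.mul h

theorem Iter.mono {n k : ℕ} {R R' : (Fin k → Fin n) → (Fin k → Fin n) → Prop}
    (h : ∀ g g', R g g' → R' g g') {m : ℕ} {g g' : Fin k → Fin n} (hg : Iter R m g g') :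
    Iter R' m g g' := by
  induction m generalizing g' with
  | zero => exact hg
  | succ m ih =>
    obtain ⟨x, h1, h2⟩ := hg
    exact ⟨x, ih h1, h _ _ h2⟩

theorem Iter.head {n k : ℕ} {R : (Fin k → Fin n) → (Fin k → Fin n) → Prop}
    (hR : ∀ g g', R g g' → StrictMono g ∧ StrictMono g') {m : ℕ} {g x g' : Fin k → Fin n}
    (h : R g x) (hx : Iter R m x g') : Iter R (m + 1) g g' := by
  induction m generalizing g' with
  | zero =>
    obtain ⟨-, rfl⟩ := hx
    exact ⟨g, ⟨(hR _ _ h).1, rfl⟩, h⟩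
  | succ m ih =>
    obtain ⟨y, h1, h2⟩ := hx
    exact ⟨y, ih h1, h2⟩

theorem Iter.flip {n k : ℕ} {R : (Fin k → Fin n) → (Fin k → Fin n) → Prop}
    (hR : ∀ g g', R g g' → StrictMono g ∧ StrictMono g') {m : ℕ} {g g' : Fin k → Fin n}
    (h : Iter R m g g') : Iter (flip R) m g' g := by
  induction m generalizing g' with
  | zero =>
    obtain ⟨hg, rfl⟩ := h
    exact ⟨hg, rfl⟩
  | succ m ih =>
    obtain ⟨y, h1, h2⟩ := h
    exact Iter.head (fun a b hab => (hR b a hab).symm) h2 (ih h1)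

/-- Idle steps pad a short path, so that descent and ascent can be given a common length before they
are superposed. -/
theorem Iter.le {n k : ℕ} {R : (Fin k → Fin n) → (Fin k → Fin n) → Prop}
    (hR : ∀ g, StrictMono g → R g g) {m m' : ℕ} (hm : m ≤ m') {g g' : Fin k → Fin n}
    (hg : StrictMono g') (h : Iter R m g g') : Iter R m' g g' := by
  induction m', hm using Nat.le_induction with
  | base => exact h
  | succ m' _ ih => exact ⟨g', ih, hR _ hg⟩

/-! ### Elementary bidiagonal factors -/

/-- At most the entry `a` of a selection is replaced by `b`, and only if `q` is positive. -/
def Hop {n k : ℕ} (a b : Fin n) (q : ℝ) (g g' : Fin k → Fin n) : Prop :=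
  StrictMono g ∧ StrictMono g' ∧ ∀ l, g' l = g l ∨ (0 < q ∧ g l = a ∧ g' l = b)

theorem det_submatrix_mul_transvection {n k : ℕ} (N : Matrix (Fin n) (Fin n) ℝ) (a b : Fin n)
    (q : ℝ) (f : Fin k → Fin n) {g : Fin k → Fin n} (hg : Injective g) {j : Fin k}
    (hj : g j = b) :
    ((N * transvection a b q).submatrix f g).det =
      (N.submatrix f g).det + q * (N.submatrix f (update g j a)).det := by
  have h1 : (N * transvection a b q).submatrix f g =
      (N.submatrix f g).updateCol j
        ((fun r => N (f r) b) + q • fun r => N (f r) a) := by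
    ext r c
    by_cases hc : c = j
    · subst hc
      simp [hj]
    · have : g c ≠ b := fun h => hc (hg (h.trans hj.symm))
      simp [hc, mul_transvection_apply_of_ne _ _ _ _ this]
  have h2 : (N.submatrix f g).updateCol j (fun r => N (f r) b) = N.submatrix f g := by
    ext r c
    by_cases hc : c = j
    · subst hc
      simp [hj]
    · simp [hc]
  have h3 : (N.submatrix f g).updateCol j (fun r => N (f r) a) =
      N.submatrix f (update g j a) := by
    ext r c
    by_cases hc : c = j
    · subst hc
      simp
    · simp [hc]
  rw [h1, det_updateCol_add, det_updateCol_smul, h2, h3]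

theorem submatrix_mul_transvection_of_notMem {n k : ℕ} (N : Matrix (Fin n) (Fin n) ℝ)
    (a b : Fin n) (q : ℝ) (f g : Fin k → Fin n) (hg : ∀ l, g l ≠ b) :
    (N * transvection a b q).submatrix f g = N.submatrix f g := by
  ext r c
  simp [mul_transvection_apply_of_ne _ _ _ _ (hg c)]

/-- As `a` and `b` are adjacent, replacing `b` by `a` either repeats a column or preserves the
order, so no negative sign can occur. -/
theorem IsTN.det_update_nonneg {n k : ℕ} {N : Matrix (Fin n) (Fin n) ℝ} (hN : IsTN N)
    {a b : Fin n} (hab : (a : ℕ) = b + 1 ∨ (b : ℕ) = a + 1) {f g : Fin k → Fin n}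
    (hf : StrictMono f) (hg : StrictMono g) {j : Fin k} (hj : g j = b) :
    0 ≤ (N.submatrix f (update g j a)).det := by
  by_cases ha : ∃ l, g l = a
  · obtain ⟨l, hl⟩ := ha
    have hlj : l ≠ j := by
      rintro rfl
      rw [hj] at hl
      rw [hl] at hab
      omega
    refine (det_zero_of_column_eq hlj fun r => ?_).ge
    simp [hlj, hl]
  · push Not at ha
    refine hN.det_nonneg hf fun l m hlm => ?_
    have h1 := hg hlm
    have h2 := ha l
    have h3 := ha m
    by_cases hl : l = j
    · subst hl
      have : m ≠ l := hlm.ne'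
      simp only [update_self, update_of_ne this]
      omega
    · by_cases hm : m = j
      · subst hm
        simp only [update_self, update_of_ne hl]
        omega
      · simpa [hl, hm] using h1

theorem det_le_det_mul_transvection {n k : ℕ} {N : Matrix (Fin n) (Fin n) ℝ} (hN : IsTN N)
    {a b : Fin n} (hab : (a : ℕ) = b + 1 ∨ (b : ℕ) = a + 1) {q : ℝ} (hq : 0 ≤ q)
    {f g : Fin k → Fin n} (hf : StrictMono f) (hg : StrictMono g) :
    (N.submatrix f g).det ≤ ((N * transvection a b q).submatrix f g).det := by
  by_cases hb : ∃ j, g j = b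
  · obtain ⟨j, hj⟩ := hb
    rw [det_submatrix_mul_transvection N a b q f hg.injective hj]
    exact le_add_of_nonneg_right (mul_nonneg hq (hN.det_update_nonneg hab hf hg hj))
  · push Not at hb
    rw [submatrix_mul_transvection_of_notMem _ _ _ _ _ _ hb]

theorem conducts_transvection {n k : ℕ} {a b : Fin n}
    (hab : (a : ℕ) = b + 1 ∨ (b : ℕ) = a + 1) {q : ℝ} (hq : 0 ≤ q) :
    Conducts (k := k) (transvection a b q) (Hop a b q) where
  isTN_mul N hN m f g := (hN m f g).trans
    (det_le_det_mul_transvection hN hab hq f.strictMono g.strictMono)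
  det_pos N hN f g g' hf := by
    rintro ⟨hg, hg', h⟩ hpos
    by_cases heq : g' = g
    · subst heq
      exact hpos.trans_le (det_le_det_mul_transvection hN hab hq hf hg')
    · obtain ⟨j, hj⟩ : ∃ j, g' j ≠ g j := by
        by_contra! hc
        exact heq (funext hc)
      obtain ⟨hq', hja, hjb⟩ := (h j).resolve_left hj
      -- Only one entry of the injective `g` can equal `a`, so exactly one entry moves.
      have hup : update g' j a = g := by
        funext l
        by_cases hl : l = j
        · subst hl
          simp [hja]
        · rw [update_of_ne hl]
          exact (h l).resolve_right fun hh => hl (hg.injective (hh.2.1.trans hja.symm))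
      rw [det_submatrix_mul_transvection N a b q f hg'.injective hjb, hup]
      exact add_pos_of_nonneg_of_pos (hN.det_nonneg hf hg') (mul_pos hq' hpos)
  sup g g' u u' h h' := by
    refine ⟨strictMono_sup h.1 h'.1, strictMono_sup h.2.1 h'.2.1, fun l => ?_⟩
    -- By adjacency of `a` and `b`, an entry that stays is either at least both and wins both
    -- maxima, or at most both and loses both.
    have key : ∀ x x' y y' : Fin n, (x' = x ∨ (0 < q ∧ x = a ∧ x' = b)) →
        (y' = y ∨ (0 < q ∧ y = a ∧ y' = b)) →
        (x' ⊔ y' = x ⊔ y ∨ (0 < q ∧ x ⊔ y = a ∧ x' ⊔ y' = b)) := by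
      rintro x x' y y' (rfl | ⟨h0, rfl, rfl⟩) (rfl | ⟨h0', h1, rfl⟩)
      · simp
      · subst h1
        simp only [h0', true_and]
        rcases le_or_gt x' y with h | h <;> rcases le_or_gt x' y' with h2 | h2 <;> grind
      · simp only [h0, true_and]
        grind
      · simp [h0, h1]
    exact key _ _ _ _ (h.2.2 l) (h'.2.2 l)

/-- The relation realized by `L_i(q)`, for `p = (i, q)`. -/
def DownStep {n k : ℕ} (p : ℕ × ℝ) (g g' : Fin k → Fin n) : Prop :=
  StrictMono g ∧ StrictMono g' ∧
    ∀ l, g' l = g l ∨ (0 < p.2 ∧ (g l : ℕ) + 1 = p.1 ∧ (g' l : ℕ) + 2 = p.1)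

theorem elemL_eq_transvection {n i : ℕ} (hi : 2 ≤ i) (hin : i ≤ n) (q : ℝ) :
    elemL n i q = transvection ⟨i - 1, by omega⟩ ⟨i - 2, by omega⟩ q := by
  ext a b
  simp only [elemL, transvection, Matrix.add_apply, of_apply, single_apply, Fin.ext_iff]
  congr 2
  apply propext
  omega

theorem conducts_elemL {n k : ℕ} {p : ℕ × ℝ} (hp : 2 ≤ p.1 ∧ p.1 ≤ n ∧ 0 ≤ p.2) :
    Conducts (k := k) (elemL n p.1 p.2) (DownStep p) := by
  have : DownStep (k := k) p =
      Hop (n := n) ⟨p.1 - 1, by omega⟩ ⟨p.1 - 2, by omega⟩ p.2 := by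
    funext g g'
    simp only [DownStep, Hop, Fin.ext_iff]
    congr! 6
    all_goals omega
  rw [elemL_eq_transvection hp.1 hp.2.1, this]
  exact conducts_transvection (Or.inl (by simp only; omega)) hp.2.2

theorem conducts_elemL_transpose {n k : ℕ} {p : ℕ × ℝ} (hp : 2 ≤ p.1 ∧ p.1 ≤ n ∧ 0 ≤ p.2) :
    Conducts (k := k) (elemL n p.1 p.2)ᵀ (flip (DownStep p)) := by
  have : flip (DownStep (k := k) p) =
      Hop (n := n) ⟨p.1 - 2, by omega⟩ ⟨p.1 - 1, by omega⟩ p.2 := by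
    funext g g'
    simp only [flip, DownStep, Hop, Fin.ext_iff]
    apply propext
    constructor
    · rintro ⟨h1, h2, h3⟩
      refine ⟨h2, h1, fun l => (h3 l).imp Eq.symm fun h => ⟨h.1, ?_, ?_⟩⟩ <;> omega
    · rintro ⟨h1, h2, h3⟩
      refine ⟨h2, h1, fun l => (h3 l).imp Eq.symm fun h => ⟨h.1, ?_, ?_⟩⟩ <;> omega
  rw [elemL_eq_transvection hp.1 hp.2.1, this]
  have ht : ∀ (a b : Fin n) (q : ℝ), (transvection a b q)ᵀ = transvection b a q := by
    intro a b q
    simp [transvection]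
  rw [ht]
  exact conducts_transvection (Or.inr (by simp only; omega)) hp.2.2

/-! ### Words -/

/-- The relation realized by a product of elementary bidiagonal matrices. -/
def Down {n k : ℕ} : LWord → (Fin k → Fin n) → (Fin k → Fin n) → Prop
  | [] => Stay
  | p :: w => Relation.Comp (DownStep p) (Down w)

theorem conducts_word {n k : ℕ} {w : LWord} (hw : ∀ p ∈ w, 2 ≤ p.1 ∧ p.1 ≤ n ∧ 0 ≤ p.2) :
    Conducts (k := k) (LWord.toMatrix n w) (Down w) := by
  induction w with
  | nil => exact conducts_one
  | cons p w ih =>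
    rw [List.forall_mem_cons] at hw
    exact (conducts_elemL hw.1).mul (ih hw.2)

/-- Transposition reverses both the order of the factors and the direction of each hop. -/
theorem conducts_word_transpose {n k : ℕ} {w : LWord}
    (hw : ∀ p ∈ w, 2 ≤ p.1 ∧ p.1 ≤ n ∧ 0 ≤ p.2) :
    Conducts (k := k) (LWord.toMatrix n w)ᵀ (flip (Down w)) := by
  induction w with
  | nil =>
    have : flip (Down (n := n) (k := k) []) = Stay := by
      funext g g'
      simp only [flip, Down, Stay]
      apply propext
      constructor <;> rintro ⟨h, rfl⟩ <;> exact ⟨h, rfl⟩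
    rw [this]
    simpa [LWord.toMatrix] using conducts_one
  | cons p w ih =>
    rw [List.forall_mem_cons] at hw
    have h1 : (LWord.toMatrix n (p :: w))ᵀ = (LWord.toMatrix n w)ᵀ * (elemL n p.1 p.2)ᵀ := by
      simp [LWord.toMatrix]
    have h2 : flip (Down (n := n) (k := k) (p :: w)) =
        Relation.Comp (flip (Down w)) (flip (DownStep p)) := by
      simp only [Down, Relation.flip_comp]
    rw [h1, h2]
    exact (ih hw.2).mul (conducts_elemL_transpose hw.1)

theorem DownStep.refl {n k : ℕ} (p : ℕ × ℝ) {g : Fin k → Fin n} (hg : StrictMono g) :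
    DownStep p g g := ⟨hg, hg, fun _ => Or.inl rfl⟩

theorem Down.strictMono {n k : ℕ} {w : LWord} {g g' : Fin k → Fin n} (h : Down w g g') :
    StrictMono g ∧ StrictMono g' := by
  induction w generalizing g with
  | nil =>
    obtain ⟨h, rfl⟩ := h
    exact ⟨h, h⟩
  | cons p w ih =>
    obtain ⟨x, h1, h2⟩ := h
    exact ⟨h1.1, (ih h2).2⟩

theorem Down.of_sublist {n k : ℕ} {w v : LWord} (hwv : w.Sublist v) {g g' : Fin k → Fin n}
    (h : Down w g g') : Down v g g' := by
  induction hwv generalizing g with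
  | slnil => exact h
  | cons p _ ih => exact ⟨g, DownStep.refl p h.strictMono.1, ih h⟩
  | cons_cons p _ ih =>
    obtain ⟨x, h1, h2⟩ := h
    exact ⟨x, h1, ih h2⟩

theorem Down.append {n k : ℕ} {w v : LWord} {g x g' : Fin k → Fin n}
    (h : Down w g x) (h' : Down v x g') : Down (w ++ v) g g' := by
  induction w generalizing g with
  | nil =>
    obtain ⟨-, rfl⟩ := h
    exact h'
  | cons p w ih =>
    obtain ⟨y, h1, h2⟩ := h
    exact ⟨y, h1, ih h2⟩

theorem Down.refl {n k : ℕ} (w : LWord) {g : Fin k → Fin n} (hg : StrictMono g) :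
    Down w g g := Down.of_sublist (List.nil_sublist w) ⟨hg, rfl⟩

theorem DownStep.down {n k : ℕ} {p : ℕ × ℝ} {g g' : Fin k → Fin n} (h : DownStep p g g') :
    Down [p] g g' := ⟨g', h, h.2.1, rfl⟩

theorem wordW_of_le {n i : ℕ} (hi : i ≤ n) (v : ℕ → ℝ) :
    wordW n i v = wordW n (i + 1) v ++ [(i, v i)] := by
  have : n + 1 - i = (n + 1 - (i + 1)) + 1 := by omega
  simp [wordW, this, List.range'_succ]

theorem wordWs_of_le {n a b : ℕ} (hab : a ≤ b) (ℓ : ℕ → ℕ → ℝ) :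
    wordWs n a b ℓ = wordW n a (ℓ a) ++ wordWs n (a + 1) b ℓ := by
  have : b + 1 - a = (b + 1 - (a + 1)) + 1 := by omega
  simp [wordWs, this, List.range'_succ]

theorem wordAsc_of_le {a b : ℕ} (hab : a ≤ b) (c : ℕ → ℝ) :
    wordAsc a b c = (a, c a) :: wordAsc (a + 1) b c := by
  have : b + 1 - a = (b + 1 - (a + 1)) + 1 := by omega
  simp [wordAsc, this, List.range'_succ]

theorem wordAsc_of_lt {a b : ℕ} (hab : b < a) (c : ℕ → ℝ) : wordAsc a b c = [] := by
  have : b + 1 - a = 0 := by omega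
  simp [wordAsc, this]

/-- `W_i` lowers any one entry of a selection to any free position that is at least `i - 1`
(counted from `1`). -/
theorem down_wordW {n k i : ℕ} (hi : i ≤ n + 1) {v : ℕ → ℝ}
    (hv : ∀ j ∈ Finset.Icc i n, 0 < v j) {g g' : Fin k → Fin n} (hg : StrictMono g)
    (hg' : StrictMono g') (j : Fin k) (hne : ∀ l, l ≠ j → g' l = g l) (hle : g' j ≤ g j)
    (hij : i ≤ (g' j : ℕ) + 2) : Down (wordW n i v) g g' := by
  induction hi using Nat.decreasingInduction generalizing g' with
  | self =>
    have : g' = g := by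
      funext l
      by_cases hl : l = j
      · subst hl
        have := (g l).2
        omega
      · exact hne l hl
    rw [this]
    exact Down.refl _ hg
  | of_succ i hin ih =>
    have hv' : ∀ j ∈ Finset.Icc (i + 1) n, 0 < v j := fun j hj => hv j (by
      rw [Finset.mem_Icc] at hj ⊢
      omega)
    rw [wordW_of_le (by omega)]
    by_cases h1 : i + 1 ≤ (g' j : ℕ) + 2
    · exact (ih hv' hg' hne hle h1).append (Down.refl _ hg')
    by_cases h2 : g' j = g j
    · have : g' = g := by
        funext l
        by_cases hl : l = j
        · rw [hl, h2]
        · exact hne l hl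
      rw [this]
      exact Down.refl _ hg
    have h3 : (g' j : ℕ) + 1 ≤ g j := by omega
    have hlt := (g j).2
    -- The stop one above the target: the factors before `L_i` lead there, and `L_i` makes the last
    -- hop.
    set x : Fin k → Fin n := update g j ⟨(g' j : ℕ) + 1, by omega⟩ with hx
    have hxm : StrictMono x := by
      intro l m hlm
      have a1 := hg hlm
      have a2 := hg' hlm
      by_cases hl : l = j
      · subst hl
        simp only [hx, update_self, update_of_ne hlm.ne']
        rw [Fin.lt_def] at a1 ⊢
        simp only
        omega
      · by_cases hm : m = j
        · subst hm
          rw [hne l hl] at a2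
          simp only [hx, update_self, update_of_ne hl]
          rw [Fin.lt_def] at a2 ⊢
          simp only
          omega
        · simpa [hx, hl, hm] using a1
    refine (ih hv' hxm (fun l hl => ?_) ?_ ?_).append (DownStep.down ⟨hxm, hg', fun l => ?_⟩)
    · simp [hx, hl]
    · simp only [hx, update_self]
      exact h3
    · simp only [hx, update_self]
      omega
    · by_cases hl : l = j
      · subst hl
        refine Or.inr ⟨hv i (by simp; omega), ?_, ?_⟩
        · simp only [hx, update_self]
          omega
        · simp only
          omega
      · left
        simp [hx, hl, hne l hl]

/-- In `W_a ⋯ W_b` the factors can be used to lower the entries with numbers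
`c, c + 1, …, c + b - a`, one after the other. -/
theorem down_wordWs {n k a b : ℕ} (hb : b ≤ n) {ℓ : ℕ → ℕ → ℝ}
    (hℓ : ∀ i ∈ Finset.Icc a b, ∀ j ∈ Finset.Icc i n, 0 < ℓ i j) (c : ℕ)
    {g g' : Fin k → Fin n} (hg : StrictMono g) (hg' : StrictMono g') (hle : ∀ l, g' l ≤ g l)
    (h : ∀ l : Fin k, g' l = g l ∨
      (c ≤ l ∧ (l : ℕ) + a ≤ b + c ∧ a + l ≤ (g' l : ℕ) + 2 + c)) :
    Down (wordWs n a b ℓ) g g' := by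
  induction hd : b + 1 - a generalizing a c g with
  | zero =>
    have : g' = g := funext fun l => (h l).resolve_right (by omega)
    rw [this]
    exact Down.refl _ hg
  | succ d ih =>
    rw [wordWs_of_le (by omega)]
    have hℓ' : ∀ i ∈ Finset.Icc (a + 1) b, ∀ j ∈ Finset.Icc i n, 0 < ℓ i j :=
      fun i hi => hℓ i (by
        rw [Finset.mem_Icc] at hi ⊢
        omega)
    have hℓa : ∀ j ∈ Finset.Icc a n, 0 < ℓ a j := hℓ a (by
      rw [Finset.mem_Icc]
      omega)
    -- `W_a` serves entry number `c` or idles; the remaining factors then start from `a + 1` and `c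
    -- + 1`. Entries below `c` are already in place, so the descent is unobstructed.
    by_cases hc : ∃ j : Fin k, (j : ℕ) = c ∧ g' j ≠ g j
    · obtain ⟨j, rfl, hj⟩ := hc
      set x : Fin k → Fin n := update g j (g' j) with hx
      have hbelow : ∀ l, l < j → g' l = g l := fun l hl => (h l).resolve_right (by omega)
      have hxm : StrictMono x := by
        intro l m hlm
        by_cases hl : l = j
        · subst hl
          simp only [hx, update_self, update_of_ne hlm.ne']
          exact (hle l).trans_lt (hg hlm)
        · by_cases hm : m = j
          · subst hm
            simp only [hx, update_self, update_of_ne hl]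
            rw [← hbelow l hlm]
            exact hg' hlm
          · simpa [hx, hl, hm] using hg hlm
      have hj' := (h j).resolve_left hj
      refine (down_wordW (by omega) hℓa hg hxm j (fun l hl => by simp [hx, hl])
        (by simpa [hx] using hle j) (by simp only [hx, update_self]; omega)).append
        (ih hℓ' (j + 1) hxm (fun l => ?_) (fun l => ?_) (by omega))
      · by_cases hl : l = j
        · simp [hx, hl]
        · simpa [hx, hl] using hle l
      · by_cases hl : l = j
        · simp [hx, hl]
        · simp only [hx, update_of_ne hl]
          refine (h l).imp_right fun h => ?_
          omega
    · push Not at hc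
      refine (Down.refl _ hg).append (ih hℓ' (c + 1) hg hle (fun l => ?_) (by omega))
      by_cases hl : (l : ℕ) = c
      · exact Or.inl (hc l hl)
      · refine (h l).imp_right fun h => ?_
        omega

/-- `L_a L_{a+1} ⋯ L_b` lowers any of the entries `a, …, b` (counted from `1`) by one. -/
theorem down_wordAsc {n k a b : ℕ} {c : ℕ → ℝ} (hc : ∀ j ∈ Finset.Icc a b, 0 < c j)
    {g g' : Fin k → Fin n} (hg : StrictMono g) (hg' : StrictMono g')
    (h : ∀ l : Fin k, g' l = g l ∨
      ((g l : ℕ) = g' l + 1 ∧ a ≤ (g l : ℕ) + 1 ∧ (g l : ℕ) + 1 ≤ b)) :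
    Down (wordAsc a b c) g g' := by
  induction hd : b + 1 - a generalizing a g with
  | zero =>
    have : g' = g := funext fun l => (h l).resolve_right (by omega)
    rw [this]
    exact Down.refl _ hg
  | succ d ih =>
    rw [wordAsc_of_le (by omega)]
    -- `L_a` moves only the entry at position `a` (counted from `1`), vacating it for the entry that
    -- `L_{a+1}` may move next.
    have hxm : StrictMono fun l => if (g l : ℕ) + 1 = a then g' l else g l := by
      intro l m hlm
      have h1 := hg hlm
      have h2 := hg' hlm
      have h3 := h l
      have h4 := h m
      simp only
      split_ifs <;> grind
    refine ⟨fun l => if (g l : ℕ) + 1 = a then g' l else g l, ⟨hg, hxm, fun l => ?_⟩,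
      ih (fun j hj => hc j ?_) hxm (fun l => ?_) (by omega)⟩
    · have h3 := h l
      have h5 := hc a (by rw [Finset.mem_Icc]; omega)
      simp only
      split_ifs with h6
      · refine h3.imp_right fun h => ⟨h5, h6, ?_⟩
        omega
      · exact Or.inl rfl
    · rw [Finset.mem_Icc] at hj ⊢
      omega
    · have h3 := h l
      split_ifs with h6
      · exact Or.inl rfl
      · refine h3.imp_right fun h => ?_
        omega

/-- Keep only the last factor `L_i` of each `W_i`. -/
theorem wordAsc_sublist_wordWs {n a b : ℕ} (hb : b ≤ n) {q : ℕ → ℝ} {ℓ : ℕ → ℕ → ℝ}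
    (hq : ∀ i ∈ Finset.Icc a b, q i = ℓ i i) :
    (wordAsc a b q).Sublist (wordWs n a b ℓ) := by
  induction hd : b + 1 - a generalizing a with
  | zero => simp [wordAsc_of_lt (show b < a by omega)]
  | succ d ih =>
    rw [wordAsc_of_le (by omega), wordWs_of_le (by omega), wordW_of_le (by omega),
      hq a (by rw [Finset.mem_Icc]; omega)]
    refine List.Sublist.append (l₁ := [(a, ℓ a a)]) (List.sublist_append_right _ _)
      (ih (fun i hi => hq i ?_) (by omega))
    rw [Finset.mem_Icc] at hi ⊢
    omega

theorem wordAsc_append {a b c : ℕ} (hab : a ≤ b + 1) (hbc : b ≤ c) (q : ℕ → ℝ) :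
    wordAsc a c q = wordAsc a b q ++ wordAsc (b + 1) c q := by
  rw [wordAsc, wordAsc, wordAsc, ← List.map_append]
  congr 1
  have := List.range'_append_1 (s := a) (m := b + 1 - a) (n := c + 1 - (b + 1))
  rw [show a + (b + 1 - a) = b + 1 by omega] at this
  rw [this]
  congr 1
  omega

theorem wordAsc_congr {a b : ℕ} {q q' : ℕ → ℝ} (h : ∀ i ∈ Finset.Icc a b, q i = q' i) :
    wordAsc a b q = wordAsc a b q' := by
  refine List.map_congr_left fun i hi => ?_
  rw [List.mem_range'_1] at hi
  rw [h i (by rw [Finset.mem_Icc]; omega)]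

/-! ### The bottom selection is reached -/

/-- The selection of the first `k` positions. -/
def bottom {n k : ℕ} (hk : k ≤ n) : Fin k → Fin n := Fin.castLE hk

theorem bottom_strictMono {n k : ℕ} (hk : k ≤ n) : StrictMono (bottom hk) :=
  Fin.strictMono_castLE hk

theorem val_le_of_strictMono {n k : ℕ} {g : Fin k → Fin n} (hg : StrictMono g) (l : Fin k) :
    (l : ℕ) ≤ g l := by
  obtain ⟨m, hm⟩ := l
  induction m with
  | zero => exact Nat.zero_le _
  | succ m ih =>
    have h1 := ih (by omega)
    have h2 : g ⟨m, by omega⟩ < g ⟨m + 1, hm⟩ := hg (by simp)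
    rw [Fin.lt_def] at h2
    simp only at h1 ⊢
    omega

/-- `μ_1(s)` copies of a word that contains `W_2 ⋯ W_s` lower every selection to the bottom. -/
theorem iter_bottom_of_isZ1Word {n k s : ℕ} (hn : 2 ≤ n) {w v : LWord} (hw : IsZ1Word n s w)
    (hwv : w.Sublist v) (hk : k ≤ n) {g : Fin k → Fin n} (hg : StrictMono g) :
    Iter (Down v) (mu n .one s) g (bottom hk) := by
  obtain ⟨hs2, hsn, ℓ, hℓ, rfl⟩ := hw
  have hmono : ∀ t, StrictMono fun l : Fin k => if (l : ℕ) < t then bottom hk l else g l := by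
    intro t l m hlm
    have h1 := hg hlm
    have h2 := val_le_of_strictMono hg m
    have h3 : ((bottom hk l : Fin n) : ℕ) = l := rfl
    have h4 : ((bottom hk m : Fin n) : ℕ) = m := rfl
    rw [Fin.lt_def] at hlm h1
    simp only
    split_ifs <;> rw [Fin.lt_def] <;> omega
  have key : ∀ t, Iter (Down v) t g
      (fun l : Fin k => if (l : ℕ) < t * (s - 1) then bottom hk l else g l) := by
    intro t
    induction t with
    | zero => exact ⟨hg, by simp⟩
    | succ t ih =>
      -- Each further copy settles the next `s - 1` entries, one for each of `W_2, …, W_s`.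
      refine ⟨_, ih, (down_wordWs hsn hℓ (t * (s - 1)) (hmono _) (hmono _) (fun l => ?_)
        fun l => ?_).of_sublist hwv⟩
      · have h2 := val_le_of_strictMono hg l
        have h3 : ((bottom hk l : Fin n) : ℕ) = l := rfl
        have h4 : (t + 1) * (s - 1) = t * (s - 1) + (s - 1) := by ring
        rw [h4]
        simp only [Fin.le_def]
        split_ifs <;> omega
      · have h3 : ((bottom hk l : Fin n) : ℕ) = l := rfl
        have h4 : (t + 1) * (s - 1) = t * (s - 1) + (s - 1) := by ring
        rw [h4]
        by_cases h5 : (l : ℕ) < t * (s - 1)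
        · left
          rw [if_pos h5, if_pos (by omega)]
        · by_cases h6 : (l : ℕ) < t * (s - 1) + (s - 1)
          · right
            rw [if_pos h6]
            omega
          · left
            rw [if_neg h5, if_neg h6]
  -- Settling entries `0, …, n - 2` suffices: an entry numbered `n - 1` can only be at position `n -
  -- 1`.
  have hμ : n - 1 ≤ mu n .one s * (s - 1) := by
    have h1 := Nat.le_ceil (((n : ℝ) - 1) / ((s : ℝ) - 1))
    have h2 : (0 : ℝ) < (s : ℝ) - 1 := by
      have : (2 : ℝ) ≤ s := by exact_mod_cast hs2
      linarith
    rw [div_le_iff₀ h2] at h1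
    have h3 : ((n - 1 : ℕ) : ℝ) ≤ ((mu n .one s * (s - 1) : ℕ) : ℝ) := by
      rw [Nat.cast_mul, Nat.cast_sub (by omega), Nat.cast_sub (by omega), Nat.cast_one]
      exact h1
    exact_mod_cast h3
  have hend : (fun l : Fin k => if (l : ℕ) < mu n .one s * (s - 1) then bottom hk l else g l) =
      bottom hk := by
    funext l
    split_ifs with h
    · rfl
    · have h1 := val_le_of_strictMono hg l
      have h2 := (g l).2
      have h3 : ((bottom hk l : Fin n) : ℕ) = l := rfl
      rw [Fin.ext_iff]
      omega
  rw [← hend]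
  exact key _

/-- Copies of a word that contains `L_2 ⋯ L_n` lower a selection to the bottom by unit shifts. -/
theorem iter_bottom_of_wordAsc {n k t : ℕ} {q : ℕ → ℝ} (hq : ∀ j ∈ Finset.Icc 2 n, 0 < q j)
    {v : LWord} (hv : (wordAsc 2 n q).Sublist v) (hk : k ≤ n) {g : Fin k → Fin n}
    (hg : StrictMono g) (ht : ∀ l, (g l : ℕ) ≤ l + t) : Iter (Down v) t g (bottom hk) := by
  induction t generalizing g with
  | zero =>
    refine ⟨hg, funext fun l => ?_⟩
    have h1 := val_le_of_strictMono hg l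
    have h2 := ht l
    exact Fin.ext (by change (g l : ℕ) = l; omega)
  | succ t ih =>
    -- The maximum with `l` holds back the entries already at the bottom.
    set x : Fin k → Fin n := fun l => ⟨max ((g l : ℕ) - 1) l, by have := (g l).2; omega⟩ with hx
    have hxm : StrictMono x := by
      intro l m hlm
      have h1 := hg hlm
      have h2 := val_le_of_strictMono hg l
      rw [Fin.lt_def] at hlm h1 ⊢
      simp only [hx]
      omega
    refine Iter.head (fun _ _ h => h.strictMono)
      ((down_wordAsc hq hg hxm fun l => ?_).of_sublist hv) (ih hxm fun l => ?_)
    · have h2 := val_le_of_strictMono hg l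
      have h3 := (g l).2
      simp only [hx, Fin.ext_iff]
      omega
    · have h2 := ht l
      simp only [hx]
      omega

/-- `μ_2(s)` copies of a word that contains a `Z_2(s)` word lower every selection to the bottom. -/
theorem iter_bottom_of_isZ2Word {n k s : ℕ} {w v : LWord} (hw : IsZ2Word n s w)
    (hwv : w.Sublist v) (hk : k ≤ n) {g : Fin k → Fin n} (hg : StrictMono g) :
    Iter (Down v) (mu n .two s) g (bottom hk) := by
  obtain ⟨hs2, hsn, ℓ, hℓ, hw⟩ := hw
  have hsub : (wordWs n s n ℓ).Sublist w := by
    rcases hw with ⟨rfl, rfl⟩ | ⟨-, c, p, -, -, rfl⟩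
    · exact List.Sublist.refl _
    · exact List.sublist_append_right _ _
  obtain ⟨q, hq, hqw⟩ : ∃ q : ℕ → ℝ, (∀ j ∈ Finset.Icc 2 n, 0 < q j) ∧
      (wordAsc 2 n q).Sublist w := by
    rcases hw with ⟨rfl, rfl⟩ | ⟨hs3, c, p, hc, hp, rfl⟩
    · refine ⟨fun j => ℓ j j, fun j hj => hℓ j hj j ?_, wordAsc_sublist_wordWs le_rfl
        fun _ _ => rfl⟩
      rw [Finset.mem_Icc] at hj ⊢
      omega
    -- A subword `L_2 ⋯ L_n` with positive multipliers: the initial `L_2 ⋯ L_{s-2}`, then `L_{s-1}`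
    -- from `P`, then the last factor of each of `W_s, …, W_n`.
    · set q : ℕ → ℝ := fun j => if j ≤ s - 2 then c j else if j = s - 1 then p j else ℓ j j
        with hqdef
      refine ⟨q, fun j hj => ?_, ?_⟩
      · rw [Finset.mem_Icc] at hj
        simp only [hqdef]
        split_ifs with h1 h2
        · exact hc j (by rw [Finset.mem_Icc]; omega)
        · rw [h2]
          exact hp.1
        · exact hℓ j (by rw [Finset.mem_Icc]; omega) j (by rw [Finset.mem_Icc]; omega)
      · rw [wordAsc_append (b := s - 2) (by omega) (by omega), List.append_assoc,
          show s - 2 + 1 = s - 1 by omega, wordAsc_of_le (a := s - 1) (by omega),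
          show s - 1 + 1 = s by omega, wordW_of_le (by omega),
          wordAsc_congr (q := q) (q' := c) (a := 2) (b := s - 2)]
        · refine (List.Sublist.refl _).append
            (List.Sublist.append (l₁ := [(s - 1, q (s - 1))]) ?_
              (wordAsc_sublist_wordWs le_rfl fun i hi => ?_))
          · have : q (s - 1) = p (s - 1) := by
              simp only [hqdef]
              rw [if_neg (by omega), if_pos trivial]
            rw [this]
            exact List.sublist_append_right _ _
          · rw [Finset.mem_Icc] at hi
            simp only [hqdef]
            rw [if_neg (by omega), if_neg (by omega)]
        · intro i hi
          rw [Finset.mem_Icc] at hi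
          simp only [hqdef]
          rw [if_pos (by omega)]
  -- In the first copy `W_{s+l}` lowers entry `l` to height at most `s - 2` above the bottom. For `l
  -- > n - s` there is no such factor, but that height already holds since positions end at `n - 1`.
  -- The other `s - 2` copies act by unit shifts.
  set x : Fin k → Fin n := fun l => ⟨min (g l) (l + (s - 2)), by have := (g l).2; omega⟩ with hx
  have hxm : StrictMono x := by
    intro l m hlm
    have h1 := hg hlm
    rw [Fin.lt_def] at hlm h1 ⊢
    simp only [hx]
    omega
  have hμ : mu n .two s = (s - 2) + 1 := by
    simp only [mu]
    omega
  rw [hμ]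
  refine Iter.head (fun _ _ h => h.strictMono)
    ((down_wordWs le_rfl hℓ 0 hg hxm (fun l => ?_) fun l => ?_).of_sublist (hsub.trans hwv))
    (iter_bottom_of_wordAsc hq (hqw.trans hwv) hk hxm fun l => ?_)
  · rw [Fin.le_def]
    exact min_le_left _ _
  · have h3 := (g l).2
    simp only [hx, Fin.ext_iff]
    omega
  · exact min_le_right _ _

theorem iter_bottom_of_isZWord {n k s : ℕ} (hn : 2 ≤ n) {i : ZIndex} {w v : LWord}
    (hw : IsZWord n i s w) (hwv : w.Sublist v) (hk : k ≤ n) {g : Fin k → Fin n}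
    (hg : StrictMono g) : Iter (Down v) (mu n i s) g (bottom hk) := by
  cases i with
  | one => exact iter_bottom_of_isZ1Word hn hw hwv hk hg
  | two => exact iter_bottom_of_isZ2Word hw hwv hk hg

/-! ### Total positivity of the power -/

theorem mem_wordW {n i : ℕ} {v : ℕ → ℝ} {p : ℕ × ℝ} (hp : p ∈ wordW n i v) :
    p.1 ∈ Finset.Icc i n ∧ p.2 = v p.1 := by
  simp only [wordW, List.mem_map, List.mem_reverse, List.mem_range'_1] at hp
  obtain ⟨j, hj, rfl⟩ := hp
  rw [Finset.mem_Icc]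
  exact ⟨by simp only; omega, rfl⟩

theorem wordWs_nonneg {n a b : ℕ} (ha : 2 ≤ a) {ℓ : ℕ → ℕ → ℝ}
    (hℓ : ∀ i ∈ Finset.Icc a b, ∀ j ∈ Finset.Icc i n, 0 < ℓ i j) :
    ∀ p ∈ wordWs n a b ℓ, 2 ≤ p.1 ∧ p.1 ≤ n ∧ 0 ≤ p.2 := by
  intro p hp
  simp only [wordWs, List.mem_flatMap, List.mem_range'_1] at hp
  obtain ⟨i, hi, hp⟩ := hp
  obtain ⟨h1, h2⟩ := mem_wordW hp
  have h3 := hℓ i (by rw [Finset.mem_Icc]; omega) p.1 h1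
  rw [Finset.mem_Icc] at h1
  exact ⟨by omega, h1.2, h2 ▸ h3.le⟩

theorem isZWord_nonneg {n s : ℕ} {i : ZIndex} {w : LWord} (hw : IsZWord n i s w) :
    ∀ p ∈ w, 2 ≤ p.1 ∧ p.1 ≤ n ∧ 0 ≤ p.2 := by
  cases i with
  | one =>
    obtain ⟨-, -, ℓ, hℓ, rfl⟩ := hw
    exact wordWs_nonneg le_rfl hℓ
  | two =>
    obtain ⟨hs2, hsn, ℓ, hℓ, ⟨rfl, rfl⟩ | ⟨hs3, c, v, hc, hv, rfl⟩⟩ := hw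
    · exact wordWs_nonneg le_rfl hℓ
    · intro p hp
      rw [List.mem_append, List.mem_append] at hp
      rcases hp with (hp | hp) | hp
      · simp only [wordAsc, List.mem_map, List.mem_range'_1] at hp
        obtain ⟨j, hj, rfl⟩ := hp
        have := hc j (by rw [Finset.mem_Icc]; omega)
        exact ⟨hj.1, by simp only; omega, this.le⟩
      · obtain ⟨h1, h2⟩ := mem_wordW hp
        rw [Finset.mem_Icc] at h1
        refine ⟨by omega, h1.2, ?_⟩
        rw [h2]
        rcases h1.1.eq_or_lt with h3 | h3
        · rw [← h3]
          exact hv.1.le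
        · exact hv.2.1 _ (by rw [Finset.mem_Icc]; omega)
      · exact wordWs_nonneg hs2 hℓ p hp

theorem zWithTerms_of_z {n s : ℕ} {i : ZIndex} : Z n i s ⊆ ZWithTerms n i s := by
  rintro _ ⟨w, hw, rfl⟩
  exact ⟨w, w, hw, List.Sublist.refl _, isZWord_nonneg hw, rfl⟩

theorem one_le_mu {n s : ℕ} (hn : 2 ≤ n) {i : ZIndex} {w : LWord} (hw : IsZWord n i s w) :
    0 < mu n i s := by
  cases i with
  | one =>
    have h1 : (2 : ℝ) ≤ n := by exact_mod_cast hn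
    have h2 : (2 : ℝ) ≤ s := by exact_mod_cast hw.1
    exact Nat.ceil_pos.2 (div_pos (by linarith) (by linarith))
  | two =>
    have := hw.1
    simp only [mu]
    omega

theorem isTN_one {n : ℕ} : IsTN (1 : Matrix (Fin n) (Fin n) ℝ) := by
  intro k f g
  by_cases hfg : ∀ l, ∃ m, g m = f l
  · have hr : Set.range f ⊆ Set.range g := by
      rintro _ ⟨l, rfl⟩
      exact hfg l
    have heq : Set.range f = Set.range g := by
      refine Set.eq_of_subset_of_ncard_le hr (le_of_eq ?_) (Set.toFinite _)
      rw [Set.ncard_range_of_injective f.injective, Set.ncard_range_of_injective g.injective]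
    have : f = g := by
      have := (StrictMono.range_inj f.strictMono g.strictMono).1 heq
      exact DFunLike.coe_injective this
    rw [this, submatrix_one _ g.injective, det_one]
    exact zero_le_one
  · push Not at hfg
    obtain ⟨l, hl⟩ := hfg
    refine (det_eq_zero_of_row_eq_zero l fun m => ?_).ge
    simp [one_apply, (hl m).symm]

theorem isTP_pow_of_zWithTerms {n : ℕ} (hn : 2 ≤ n) {L U : Matrix (Fin n) (Fin n) ℝ}
    {d : Fin n → ℝ} (hd : ∀ a, 0 < d a) {i j : ZIndex} {si sj : ℕ}
    (hL : L ∈ ZWithTerms n i si) (hU : Uᵀ ∈ ZWithTerms n j sj) {m : ℕ}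
    (hi : mu n i si ≤ m) (hj : mu n j sj ≤ m) : IsTP ((L * diagonal d * U) ^ m) := by
  obtain ⟨w, v, hw, hwv, hv, rfl⟩ := hL
  obtain ⟨w', v', hw', hwv', hv', hU⟩ := hU
  obtain rfl : U = (LWord.toMatrix n v')ᵀ := by rw [← hU, transpose_transpose]
  intro k f g
  have hk : k ≤ n := by simpa using Fintype.card_le_of_injective f f.injective
  have hA := (((conducts_word (k := k) hv).mul (conducts_diagonal hd)).mul
    (conducts_word_transpose hv')).pow m
  have hbot := bottom_strictMono hk
  have hdown := Iter.mono (R' := Relation.Comp (Relation.Comp (Down v) Stay) (flip (Down v')))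
    (fun x y hxy => ⟨y, ⟨y, hxy, hxy.strictMono.2, rfl⟩, Down.refl v' hxy.strictMono.2⟩)
    (Iter.le (fun _ => Down.refl v) hi hbot
      (iter_bottom_of_isZWord hn hw hwv hk f.strictMono))
  have hup := Iter.mono (R' := Relation.Comp (Relation.Comp (Down v) Stay) (flip (Down v')))
    (fun x y (hxy : Down v' y x) =>
      ⟨x, ⟨x, Down.refl v hxy.strictMono.2, hxy.strictMono.2, rfl⟩, hxy⟩)
    (Iter.flip (fun _ _ h => h.strictMono) (Iter.le (fun _ => Down.refl v') hj hbot
      (iter_bottom_of_isZWord hn hw' hwv' hk g.strictMono)))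
  have hsup := hA.sup _ _ _ _ hdown hup
  -- The bottom selection is least, so the superposed path runs from `f ⊔ bottom = f` to `bottom ⊔ g
  -- = g`.
  have hbot_le : ∀ x : Fin k → Fin n, StrictMono x → bottom hk ≤ x := fun x hx l =>
    val_le_of_strictMono hx l
  rw [sup_eq_left.2 (hbot_le _ f.strictMono), sup_eq_right.2 (hbot_le _ g.strictMono)] at hsup
  have := hA.det_pos 1 isTN_one f f g f.strictMono hsup
    (by rw [submatrix_one _ f.injective, det_one]; exact one_pos)
  rwa [one_mul] at this

end OscExp

theorem corollary3 (n : ℕ) (hn : 2 ≤ n) (A L U : Matrix (Fin n) (Fin n) ℝ) (d : Fin n → ℝ)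
    (hd : ∀ k, 0 < d k) (hLDU : A = L * Matrix.diagonal d * U) (hA : OscExp.IsOscillatory A)
    (i j : OscExp.ZIndex) (si sj : ℕ)
    (h : (L ∈ OscExp.Z n i si ∧ U.transpose ∈ OscExp.ZWithTerms n j sj) ∨
      (U.transpose ∈ OscExp.Z n j sj ∧ L ∈ OscExp.ZWithTerms n i si)) :
    OscExp.exponent A ≤ max (OscExp.mu n i si) (OscExp.mu n j sj) := by
  obtain ⟨hL, hU⟩ : L ∈ OscExp.ZWithTerms n i si ∧ U.transpose ∈ OscExp.ZWithTerms n j sj := by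
    rcases h with ⟨h1, h2⟩ | ⟨h1, h2⟩
    · exact ⟨OscExp.zWithTerms_of_z h1, h2⟩
    · exact ⟨h2, OscExp.zWithTerms_of_z h1⟩
  -- The exponent ranges over positive powers only, so the bound itself must be shown positive.
  refine Nat.sInf_le ⟨?_, ?_⟩
  · obtain ⟨w, _, hw, -⟩ := hL
    exact lt_max_of_lt_left (OscExp.one_le_mu hn hw)
  · rw [hLDU]
    exact OscExp.isTP_pow_of_zWithTerms hn hd hL hU (le_max_left _ _) (le_max_right _ _)
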